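/- Let $d\in\mathbb{N}$ and let $\nu:\mathbb{R}^d\to[0,\infty)$ be a symmetric Lévy kernel, that is, $\nu(h)=\nu(-h)$ for all $h$ and $\int_{\mathbb{R}^d}(1\wedge|h|^2)\,\nu(h)\,dh<\infty$. Put $$\psi(\xi)=2\int_{\mathbb{R}^d}(1-\cos(\xi\cdot h))\,\nu(h)\,dh,\qquad \xi\in\mathbb{R}^d.$$ Let $\mathcal{P}_2(\mathbb{R}^d)$ be the set of Borel probability measures $u$ on $\mathbb{R}^d$ with $\int|x|^2\,du(x)<\infty$, let $$W(u_0,u_1)=\inf_{\gamma}\Big(\iint_{\mathbb{R}^d\times\mathbb{R}^d}|x-y|^2\,d\gamma(x,y)\Big)^{1/2}$$ be the $2$-Wasserstein distance, where $\gamma$ ranges over the probability measures on $\mathbb{R}^d\times\mathbb{R}^d$ with marginals $u_0$ and $u_1$, and let $\mathcal{F}:\mathcal{P}_2(\mathbb{R}^d)\to[0,\infty]$, $$\mathcal{F}(u)=\frac12\int_{\mathbb{R}^d}|\widehat{u}(\xi)|^2\,\psi(\xi)^{-1}\,d\xi,\qquad \widehat{u}(\xi)=(2\pi)^{-d/2}\int_{\mathbb{R}^d}e^{-i\xi\cdot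 x}\,du(x),$$ with $\psi(\xi)^{-1}=\infty$ where $\psi(\xi)=0$. Let $u_*\in\mathcal{P}_2(\mathbb{R}^d)$ and $\tau>0$. Then the functional $$u\mapsto \frac{1}{2\tau}W^2(u,u_*)+\mathcal{F}(u)$$ is lower semicontinuous on $\mathcal{P}_2(\mathbb{R}^d)$ with respect to narrow convergence. Moreover, if $\mathcal{F}$ is not identically $+\infty$ on $\mathcal{P}_2(\mathbb{R}^d)$, then this functional has a unique minimizer in $\mathcal{P}_2(\mathbb{R}^d)$. -/

import Mathlib

noncomputable section

open MeasureTheory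
open scoped ENNReal RealInnerProductSpace

namespace LevyEnergy

/-- `ℝ^d` with the Euclidean norm. -/
abbrev Rd (d : ℕ) : Type := EuclideanSpace ℝ (Fin d)

/-- `ν ≥ 0` is the Lebesgue density of a symmetric Lévy measure on `ℝ^d`. (Measurability of `ν`,
up to a null set, is part of the integrability of `(1 ∧ |h|²) ν(h)`.) -/
structure IsLevyKernel {d : ℕ} (ν : Rd d → ℝ) : Prop where
  nonneg : ∀ h, 0 ≤ ν h
  even : ∀ h, ν (-h) = ν h
  integrable : Integrable (fun h : Rd d => min 1 (‖h‖ ^ 2) * ν h)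

/-- The Fourier symbol `ψ(ξ) = 2 ∫ (1 - cos (ξ · h)) ν(h) dh` of the Lévy operator. -/
def symbol {d : ℕ} (ν : Rd d → ℝ) (ξ : Rd d) : ℝ :=
  2 * ∫ h : Rd d, (1 - Real.cos ⟪ξ, h⟫) * ν h

/-- The Fourier transform `û(ξ) = (2π)^(-d/2) ∫ exp(-i ξ · x) du(x)` of a probability measure. -/
def fourier {d : ℕ} (u : ProbabilityMeasure (Rd d)) (ξ : Rd d) : ℂ :=
  (((2 * Real.pi) ^ (-(d : ℝ) / 2) : ℝ) : ℂ) *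
    ∫ x : Rd d, Complex.exp (-(Complex.I * ((⟪ξ, x⟫ : ℝ) : ℂ))) ∂(u : Measure (Rd d))

/-- The energy `F(u) = (1/2) ∫ |û(ξ)|² ψ(ξ)⁻¹ dξ`, with values in `[0, ∞]`. The inverse is taken
in `[0, ∞]`, so that `ψ(ξ)⁻¹ = ∞` where `ψ(ξ) = 0`. -/
def energy {d : ℕ} (ν : Rd d → ℝ) (u : ProbabilityMeasure (Rd d)) : ℝ≥0∞ :=
  2⁻¹ * ∫⁻ ξ : Rd d, ‖fourier u ξ‖ₑ ^ 2 * (ENNReal.ofReal (symbol ν ξ))⁻¹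

/-- `P₂(ℝ^d)`: the Borel probability measures with finite second moment. As a subset of
`ProbabilityMeasure (Rd d)` it carries the topology of narrow convergence. -/
def P2 (d : ℕ) : Set (ProbabilityMeasure (Rd d)) :=
  {u | ∫⁻ x : Rd d, ‖x‖ₑ ^ 2 ∂(u : Measure (Rd d)) < ∞}

/-- The transport plans between `u₀` and `u₁`. -/
def plans {d : ℕ} (u₀ u₁ : ProbabilityMeasure (Rd d)) : Set (ProbabilityMeasure (Rd d × Rd d)) :=
  {γ | (γ : Measure (Rd d × Rd d)).map Prod.fst = u₀ ∧
    (γ : Measure (Rd d × Rd d)).map Prod.snd = u₁}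

/-- The `2`-Wasserstein distance. -/
def W {d : ℕ} (u₀ u₁ : ProbabilityMeasure (Rd d)) : ℝ≥0∞ :=
  (⨅ γ ∈ plans u₀ u₁,
    ∫⁻ p : Rd d × Rd d, ‖p.1 - p.2‖ₑ ^ 2 ∂(γ : Measure (Rd d × Rd d))) ^ (1 / 2 : ℝ)

/-- The effective domain `D(F) = {u ∈ P₂(ℝ^d) : F(u) < ∞}`. -/
def energyDomain {d : ℕ} (ν : Rd d → ℝ) : Set (ProbabilityMeasure (Rd d)) :=
  {u ∈ P2 d | energy ν u < ∞}

/-- The Moreau–Yosida penalization `u ↦ W²(u, u_*) / (2τ) + F(u)`. -/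
def moreauYosida {d : ℕ} (ν : Rd d → ℝ) (τ : ℝ) (uStar u : ProbabilityMeasure (Rd d)) : ℝ≥0∞ :=
  W u uStar ^ 2 / ENNReal.ofReal (2 * τ) + energy ν u

end LevyEnergy

end

/-! This is the direct method plus strict convexity. `W²(·, uStar)` is narrowly lower semicontinuous
by compactness of plans of bounded cost, and the energy is so by Fatou, because `û(ξ)` depends
continuously on `u` for each `ξ`. A bound on the functional bounds second moments
(`secondMoment_le_moreauYosida`), which gives tightness and, by Prokhorov, a minimizer. For
uniqueness, interpolate linearly between measures, not along geodesics: `W²` is convex because plans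
can be averaged, while the parallelogram law makes the quadratic energy strictly convex. -/

noncomputable section

open MeasureTheory Filter Topology
open scoped ENNReal NNReal RealInnerProductSpace BoundedContinuousFunction

namespace LevyEnergy

/-! ### Narrow lower semicontinuity and compactness from second moments. -/

section WeakConvergence

/-- Integration of a continuous nonnegative function is lower semicontinuous for narrow
convergence. -/
theorem lowerSemicontinuous_lintegral {E : Type*} [TopologicalSpace E] [MeasurableSpace E]
    [OpensMeasurableSpace E] {f : E → ℝ≥0} (hf : Continuous f) :
    LowerSemicontinuous fun μ : ProbabilityMeasure E => ∫⁻ x, (f x : ℝ≥0∞) ∂(μ : Measure E) := by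
  -- Truncating at `n` makes the integrand bounded, so each term of the supremum is narrowly
  -- continuous.
  have key : (fun μ : ProbabilityMeasure E => ∫⁻ x, (f x : ℝ≥0∞) ∂(μ : Measure E)) =
      fun μ : ProbabilityMeasure E =>
        ⨆ n : ℕ, ∫⁻ x, ((min (f x) n : ℝ≥0) : ℝ≥0∞) ∂(μ : Measure E) := by
    ext μ
    rw [← lintegral_iSup]
    · congr with x
      refine le_antisymm ?_ (iSup_le fun n => by simp)
      obtain ⟨n, hn⟩ := exists_nat_ge (f x)
      exact le_iSup_of_le n (by simp [hn])
    · intro n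
      exact (hf.min continuous_const).measurable.coe_nnreal_ennreal
    · intro m n hmn x
      have : (m : ℝ≥0) ≤ n := by exact_mod_cast hmn
      simp only [ENNReal.coe_le_coe]
      exact min_le_min le_rfl this
  rw [key]
  refine lowerSemicontinuous_iSup fun n => ?_
  let g : E →ᵇ ℝ≥0 := BoundedContinuousFunction.mkOfBound
    ⟨fun x => min (f x) n, hf.min continuous_const⟩ n (by
      intro x y
      rw [NNReal.dist_eq, abs_sub_le_iff]
      have h₁ : ((min (f x) n : ℝ≥0) : ℝ) ≤ n := by exact_mod_cast min_le_right (f x) (n : ℝ≥0)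
      have h₂ : ((min (f y) n : ℝ≥0) : ℝ) ≤ n := by exact_mod_cast min_le_right (f y) (n : ℝ≥0)
      have h₃ := (min (f x) n : ℝ≥0).2
      have h₄ := (min (f y) n : ℝ≥0).2
      simp only [ContinuousMap.coe_mk]
      constructor <;> linarith!)
  exact (ProbabilityMeasure.continuous_lintegral_boundedContinuousFunction g).lowerSemicontinuous

theorem lowerSemicontinuous_lintegral_enorm_sq {E F : Type*} [TopologicalSpace E]
    [MeasurableSpace E] [OpensMeasurableSpace E] [SeminormedAddCommGroup F] {g : E → F}
    (hg : Continuous g) :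
    LowerSemicontinuous fun μ : ProbabilityMeasure E => ∫⁻ x, ‖g x‖ₑ ^ 2 ∂(μ : Measure E) := by
  simpa [enorm_eq_nnnorm] using lowerSemicontinuous_lintegral (hg.nnnorm.pow 2)

/-- The probability measures on a proper space with second moment at most `C` form a compact set. -/
theorem isCompact_secondMoment_le {E : Type*} [NormedAddCommGroup E] [ProperSpace E]
    [MeasurableSpace E] [BorelSpace E] {C : ℝ≥0∞} (hC : C ≠ ∞) :
    IsCompact {μ : ProbabilityMeasure E | ∫⁻ x, ‖x‖ₑ ^ 2 ∂(μ : Measure E) ≤ C} := by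
  have hclosed : IsClosed {μ : ProbabilityMeasure E | ∫⁻ x, ‖x‖ₑ ^ 2 ∂(μ : Measure E) ≤ C} :=
    (lowerSemicontinuous_lintegral_enorm_sq continuous_id).isClosed_preimage C
  rw [← hclosed.closure_eq]
  apply isCompact_closure_of_isTightMeasureSet
  rw [isTightMeasureSet_iff_exists_isCompact_measure_compl_le]
  intro ε hε
  obtain ⟨n, hn⟩ := ENNReal.exists_nat_gt (ENNReal.div_lt_top hC hε.ne').ne
  -- Markov's inequality leaves mass at most `C / (n + 1)²` outside the ball; this is at most `ε`
  -- since `n > C / ε` and `(n + 1)² ≥ n`.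
  refine ⟨Metric.closedBall 0 (n + 1), isCompact_closedBall _ _, ?_⟩
  rintro _ ⟨μ, hμ, rfl⟩
  have hpos : ((n + 1 : ℝ≥0) : ℝ≥0∞) ^ 2 ≠ 0 := by positivity
  have hfin : ((n + 1 : ℝ≥0) : ℝ≥0∞) ^ 2 ≠ ∞ := by finiteness
  calc (μ : Measure E) (Metric.closedBall 0 (n + 1))ᶜ
      ≤ (μ : Measure E) {x | ((n + 1 : ℝ≥0) : ℝ≥0∞) ^ 2 ≤ ‖x‖ₑ ^ 2} := by
        apply measure_mono
        intro x hx
        simp only [Set.mem_compl_iff, Metric.mem_closedBall, dist_zero_right, not_le] at hx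
        simp only [Set.mem_ofPred_eq]
        gcongr
        rw [enorm_eq_nnnorm, ENNReal.coe_le_coe, ← NNReal.coe_le_coe]
        push_cast
        exact hx.le
    _ ≤ (∫⁻ x, ‖x‖ₑ ^ 2 ∂(μ : Measure E)) / ((n + 1 : ℝ≥0) : ℝ≥0∞) ^ 2 :=
        meas_ge_le_lintegral_div (by fun_prop) hpos hfin
    _ ≤ C / ((n + 1 : ℝ≥0) : ℝ≥0∞) ^ 2 := by gcongr; exact hμ
    _ ≤ ε := by
        rw [ENNReal.div_le_iff hpos hfin]
        have h1 : C ≤ n * ε := by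
          by_cases h : ε = ∞
          · rcases eq_or_ne n 0 with rfl | hn0
            · simp at hn
            · simp [h, hn0]
          · exact (ENNReal.div_le_iff hε.ne' h).1 hn.le
        have h2 : (n : ℝ≥0∞) ≤ ((n + 1 : ℝ≥0) : ℝ≥0∞) ^ 2 := by
          norm_cast
          nlinarith
        rw [mul_comm]
        exact h1.trans (by gcongr)

end WeakConvergence

/-! ### Transport cost: coercivity and lower semicontinuity. -/

section Wasserstein

variable {d : ℕ}

theorem enorm_sq_le_two_mul {E : Type*} [SeminormedAddCommGroup E] (x y : E) :
    ‖x‖ₑ ^ 2 ≤ 2 * ‖x - y‖ₑ ^ 2 + 2 * ‖y‖ₑ ^ 2 := by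
  have h : ‖x‖₊ ≤ ‖x - y‖₊ + ‖y‖₊ := by simpa using nnnorm_add_le (x - y) y
  simp only [enorm_eq_nnnorm]
  norm_cast
  rw [← NNReal.coe_le_coe] at h ⊢
  push_cast at h ⊢
  nlinarith [sq_nonneg (‖x - y‖ - ‖y‖), norm_nonneg x, norm_nonneg y, norm_nonneg (x - y)]

theorem W_sq (u v : ProbabilityMeasure (Rd d)) :
    W u v ^ 2 = ⨅ γ ∈ plans u v,
      ∫⁻ p : Rd d × Rd d, ‖p.1 - p.2‖ₑ ^ 2 ∂(γ : Measure (Rd d × Rd d)) := by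
  rw [W, ← ENNReal.rpow_natCast, ← ENNReal.rpow_mul]
  norm_num

theorem lintegral_fst_of_mem_plans {u v : ProbabilityMeasure (Rd d)}
    {γ : ProbabilityMeasure (Rd d × Rd d)} (hγ : γ ∈ plans u v) {f : Rd d → ℝ≥0∞}
    (hf : Measurable f) :
    ∫⁻ p, f p.1 ∂(γ : Measure (Rd d × Rd d)) = ∫⁻ x, f x ∂(u : Measure (Rd d)) := by
  rw [← hγ.1, lintegral_map hf measurable_fst]

theorem lintegral_snd_of_mem_plans {u v : ProbabilityMeasure (Rd d)}
    {γ : ProbabilityMeasure (Rd d × Rd d)} (hγ : γ ∈ plans u v) {f : Rd d → ℝ≥0∞}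
    (hf : Measurable f) :
    ∫⁻ p, f p.2 ∂(γ : Measure (Rd d × Rd d)) = ∫⁻ x, f x ∂(v : Measure (Rd d)) := by
  rw [← hγ.2, lintegral_map hf measurable_snd]

theorem secondMoment_le_of_mem_plans {u v : ProbabilityMeasure (Rd d)}
    {γ : ProbabilityMeasure (Rd d × Rd d)} (hγ : γ ∈ plans u v) :
    ∫⁻ x, ‖x‖ₑ ^ 2 ∂(u : Measure (Rd d)) ≤
      2 * ∫⁻ p, ‖p.1 - p.2‖ₑ ^ 2 ∂(γ : Measure (Rd d × Rd d)) +
        2 * ∫⁻ x, ‖x‖ₑ ^ 2 ∂(v : Measure (Rd d)) := by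
  rw [← lintegral_fst_of_mem_plans hγ (by fun_prop), ← lintegral_snd_of_mem_plans hγ (by fun_prop),
    ← lintegral_const_mul _ (by fun_prop), ← lintegral_const_mul _ (by fun_prop),
    ← lintegral_add_left (by fun_prop)]
  exact lintegral_mono fun p => enorm_sq_le_two_mul _ _

theorem secondMoment_le_W (u v : ProbabilityMeasure (Rd d)) :
    ∫⁻ x, ‖x‖ₑ ^ 2 ∂(u : Measure (Rd d)) ≤
      2 * W u v ^ 2 + 2 * ∫⁻ x, ‖x‖ₑ ^ 2 ∂(v : Measure (Rd d)) := by
  rw [W_sq, iInf_subtype', ENNReal.mul_iInf_of_ne (by simp) (by simp), ENNReal.iInf_add]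
  exact le_iInf fun γ => secondMoment_le_of_mem_plans γ.2

theorem W_sq_lt_top {u v : ProbabilityMeasure (Rd d)} (hu : u ∈ P2 d) (hv : v ∈ P2 d) :
    W u v ^ 2 < ∞ := by
  have hγ : u.prod v ∈ plans u v := by
    constructor <;> simp
  rw [W_sq]
  refine (iInf₂_le _ hγ).trans_lt ?_
  calc ∫⁻ p, ‖p.1 - p.2‖ₑ ^ 2 ∂((u.prod v : ProbabilityMeasure _) : Measure (Rd d × Rd d))
      ≤ ∫⁻ p, (2 * ‖p.1‖ₑ ^ 2 + 2 * ‖p.2‖ₑ ^ 2)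
          ∂((u.prod v : ProbabilityMeasure _) : Measure (Rd d × Rd d)) := by
        refine lintegral_mono fun p => ?_
        simpa using enorm_sq_le_two_mul (p.1 - p.2) (-p.2)
    _ < ∞ := by
        rw [lintegral_add_left (by fun_prop), lintegral_const_mul _ (by fun_prop),
          lintegral_const_mul _ (by fun_prop),
          lintegral_fst_of_mem_plans hγ (f := fun x => ‖x‖ₑ ^ 2) (by fun_prop),
          lintegral_snd_of_mem_plans hγ (f := fun x => ‖x‖ₑ ^ 2) (by fun_prop)]
        exact ENNReal.add_lt_top.2 ⟨ENNReal.mul_lt_top (by simp) hu, ENNReal.mul_lt_top (by simp) hv⟩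

/-- The plans with second marginal `v` and cost at most `c` form a compact set. -/
theorem isCompact_plans_cost_le {v : ProbabilityMeasure (Rd d)} (hv : v ∈ P2 d) {c : ℝ≥0∞}
    (hc : c ≠ ∞) :
    IsCompact {γ : ProbabilityMeasure (Rd d × Rd d) |
      γ.map (f := Prod.snd) measurable_snd.aemeasurable = v ∧
        ∫⁻ p, ‖p.1 - p.2‖ₑ ^ 2 ∂(γ : Measure (Rd d × Rd d)) ≤ c} := by
  have hM : ∫⁻ x, ‖x‖ₑ ^ 2 ∂(v : Measure (Rd d)) ≠ ∞ := ne_of_lt hv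
  set M := ∫⁻ x, ‖x‖ₑ ^ 2 ∂(v : Measure (Rd d)) with hMdef
  have hcpt := isCompact_secondMoment_le (E := Rd d × Rd d) (C := 2 * c + 2 * M + M)
    (by finiteness)
  refine hcpt.of_isClosed_subset ?_ ?_
  · exact (isClosed_eq (ProbabilityMeasure.continuous_map continuous_snd)
      continuous_const).inter
      ((lowerSemicontinuous_lintegral_enorm_sq
        (continuous_fst.sub continuous_snd)).isClosed_preimage c)
  · rintro γ ⟨hγ, hcost⟩
    have hplan : γ ∈ plans (γ.map (f := Prod.fst) measurable_fst.aemeasurable) v :=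
      ⟨rfl, by rw [← hγ]; rfl⟩
    calc ∫⁻ p, ‖p‖ₑ ^ 2 ∂(γ : Measure (Rd d × Rd d))
        ≤ ∫⁻ p, (‖p.1‖ₑ ^ 2 + ‖p.2‖ₑ ^ 2) ∂(γ : Measure (Rd d × Rd d)) := by
          refine lintegral_mono fun p => ?_
          simp only [enorm_eq_nnnorm, Prod.nnnorm_def]
          norm_cast
          rcases le_total ‖p.1‖₊ ‖p.2‖₊ with h | h
          · rw [sup_eq_right.2 h]; exact le_add_self
          · rw [sup_eq_left.2 h]; exact le_self_add
      _ ≤ (2 * c + 2 * M) + M := by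
          rw [lintegral_add_left (by fun_prop),
            lintegral_fst_of_mem_plans hplan (f := fun x => ‖x‖ₑ ^ 2) (by fun_prop),
            lintegral_snd_of_mem_plans hplan (f := fun x => ‖x‖ₑ ^ 2) (by fun_prop)]
          gcongr
          exact (secondMoment_le_of_mem_plans hplan).trans (by gcongr)

/-- No optimal plan is needed: a sublevel set is an intersection, over finite `b > c`, of
first-marginal images of compact sets of plans, hence closed. -/
theorem lowerSemicontinuous_W_sq {v : ProbabilityMeasure (Rd d)} (hv : v ∈ P2 d) :
    LowerSemicontinuous fun u => W u v ^ 2 := by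
  rw [lowerSemicontinuous_iff_isClosed_preimage]
  intro c
  have key : (fun u => W u v ^ 2) ⁻¹' Set.Iic c = ⋂ (b : ℝ≥0∞) (_ : c < b) (_ : b ≠ ∞),
      (fun γ : ProbabilityMeasure (Rd d × Rd d) =>
        γ.map (f := Prod.fst) measurable_fst.aemeasurable) ''
        {γ | γ.map (f := Prod.snd) measurable_snd.aemeasurable = v ∧
          ∫⁻ p, ‖p.1 - p.2‖ₑ ^ 2 ∂(γ : Measure (Rd d × Rd d)) ≤ b} := by
    ext u
    simp only [Set.mem_preimage, Set.mem_Iic, Set.mem_iInter, W_sq]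
    constructor
    · intro h b hb _
      obtain ⟨γ, hγ, hlt⟩ := by simpa only [iInf_lt_iff] using h.trans_lt hb
      exact ⟨γ, ⟨Subtype.ext hγ.2, hlt.le⟩, Subtype.ext hγ.1⟩
    · intro h
      refine le_of_forall_gt_imp_ge_of_dense fun b hb => ?_
      rcases eq_or_ne b ∞ with rfl | hb'
      · exact le_top
      obtain ⟨γ, ⟨h₂, hcost⟩, h₁⟩ := h b hb hb'
      exact (iInf₂_le γ ⟨congrArg Subtype.val h₁, congrArg Subtype.val h₂⟩).trans hcost
  rw [key]
  exact isClosed_iInter fun b => isClosed_iInter fun _ => isClosed_iInter fun hb =>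
    ((isCompact_plans_cost_le hv hb).image
      (ProbabilityMeasure.continuous_map continuous_fst)).isClosed

end Wasserstein

/-! ### Fourier energy: lower semicontinuity and strict midpoint convexity. -/

section Energy

variable {d : ℕ}

theorem fourier_eq_charFun (u : ProbabilityMeasure (Rd d)) (ξ : Rd d) :
    fourier u ξ = (((2 * Real.pi) ^ (-(d : ℝ) / 2) : ℝ) : ℂ) *
      charFun (u : Measure (Rd d)) (-ξ) := by
  rw [fourier, charFun_apply]
  congr 2 with x
  congr 1
  rw [inner_neg_right, real_inner_comm]
  push_cast
  ring

theorem continuous_fourier (u : ProbabilityMeasure (Rd d)) : Continuous (fourier u) := by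
  rw [show fourier u = _ from funext (fourier_eq_charFun u)]
  exact continuous_const.mul (continuous_charFun.comp continuous_neg)

theorem continuous_fourier_apply (ξ : Rd d) :
    Continuous fun u : ProbabilityMeasure (Rd d) => fourier u ξ := by
  simp only [fourier_eq_charFun, charFun_eq_integral_innerProbChar]
  refine continuous_const.mul ?_
  rw [continuous_iff_continuousAt]
  intro u
  exact (ProbabilityMeasure.tendsto_iff_forall_integral_rclike_tendsto ℂ).1 tendsto_id _

theorem fourier_injective : Function.Injective (fourier (d := d)) := by
  intro u v h
  apply Subtype.ext
  refine Measure.ext_of_charFun (μ := (u : Measure (Rd d))) (ν := (v : Measure (Rd d))) ?_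
  ext ξ
  have hc : (((2 * Real.pi) ^ (-(d : ℝ) / 2) : ℝ) : ℂ) ≠ 0 :=
    Complex.ofReal_ne_zero.2 (by positivity)
  have := congrFun h (-ξ)
  rw [fourier_eq_charFun, fourier_eq_charFun, neg_neg] at this
  exact mul_left_cancel₀ hc this

theorem measurable_symbol {ν : Rd d → ℝ} (hν : IsLevyKernel ν) : Measurable (symbol ν) := by
  let m : Rd d → ℝ := fun h => min 1 (‖h‖ ^ 2)
  have hg : AEStronglyMeasurable (fun h => m h * ν h) volume := hν.integrable.1
  -- Only `m * ν` is known to be a.e. strongly measurable, so `ν` is replaced by `hg.mk / m`. At `h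
  -- = 0` both integrands vanish.
  have key : symbol ν = fun ξ : Rd d =>
      2 * ∫ h : Rd d, (1 - Real.cos ⟪ξ, h⟫) / m h * hg.mk _ h := by
    ext ξ
    rw [symbol]
    congr 1
    apply integral_congr_ae
    filter_upwards [hg.ae_eq_mk] with h hh
    rw [← hh]
    rcases eq_or_ne h 0 with rfl | h0
    · simp
    · have : m h ≠ 0 := by
        have : 0 < ‖h‖ := norm_pos_iff.2 h0
        exact ne_of_gt (lt_min one_pos (by positivity))
      field_simp
  rw [key]
  refine Measurable.const_mul ?_ 2
  apply StronglyMeasurable.measurable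
  refine StronglyMeasurable.integral_prod_right
    (f := fun ξ h : Rd d => (1 - Real.cos ⟪ξ, h⟫) / m h * hg.mk _ h) ?_
  apply Measurable.stronglyMeasurable
  have h₁ : Measurable (hg.mk _) := hg.stronglyMeasurable_mk.measurable
  have h₂ : Measurable m := by fun_prop
  have h₃ : Measurable fun p : Rd d × Rd d => Real.cos ⟪p.1, p.2⟫ :=
    (Real.continuous_cos.comp continuous_inner).measurable
  exact ((h₃.const_sub 1).div (h₂.comp measurable_snd)).mul (h₁.comp measurable_snd)

theorem measurable_energy_density {ν : Rd d → ℝ} (hν : IsLevyKernel ν)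
    {f : Rd d → ℂ} (hf : Continuous f) :
    Measurable fun ξ => ‖f ξ‖ₑ ^ 2 * (ENNReal.ofReal (symbol ν ξ))⁻¹ :=
  (hf.enorm.measurable.pow_const 2).mul (measurable_symbol hν).ennreal_ofReal.inv

theorem lowerSemicontinuous_energy {ν : Rd d → ℝ} (hν : IsLevyKernel ν) :
    LowerSemicontinuous (energy ν) := by
  have h : LowerSemicontinuous fun u : ProbabilityMeasure (Rd d) =>
      ∫⁻ ξ : Rd d, ‖fourier u ξ‖ₑ ^ 2 * (ENNReal.ofReal (symbol ν ξ))⁻¹ := by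
    rw [lowerSemicontinuous_iff_le_liminf]
    intro u
    refine le_trans (lintegral_mono fun ξ => ?_)
      (lintegral_liminf_le fun v => measurable_energy_density hν (continuous_fourier v))
    -- The weight may be `∞`, and multiplication by `∞` is discontinuous at `0`; there the limit
    -- density is `0 * ∞ = 0` and the bound is trivial.
    rcases eq_or_ne (fourier u ξ) 0 with h0 | h0
    · simp [h0]
    · refine (Tendsto.liminf_eq ?_).ge
      refine ENNReal.Tendsto.mul_const ?_ (Or.inl (by simpa using h0))
      exact ENNReal.Tendsto.pow (continuous_fourier_apply ξ).enorm.continuousAt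
  exact Continuous.comp_lowerSemicontinuous (g := fun x : ℝ≥0∞ => 2⁻¹ * x)
    (ENNReal.continuous_const_mul (by simp)) h fun a b hab => mul_le_mul_right hab _

/-- The midpoint of two probability measures in the linear structure of measures. -/
def midpoint {E : Type*} [MeasurableSpace E] (u v : ProbabilityMeasure E) :
    ProbabilityMeasure E :=
  ⟨(2⁻¹ : ℝ≥0∞) • (u : Measure E) + (2⁻¹ : ℝ≥0∞) • (v : Measure E),
    ⟨by simp [ENNReal.inv_two_add_inv_two]⟩⟩

theorem toMeasure_midpoint {E : Type*} [MeasurableSpace E] (u v : ProbabilityMeasure E) :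
    (midpoint u v : Measure E) = (2⁻¹ : ℝ≥0∞) • (u : Measure E) + (2⁻¹ : ℝ≥0∞) • (v : Measure E) :=
  rfl

theorem lintegral_midpoint {E : Type*} [MeasurableSpace E] (u v : ProbabilityMeasure E)
    (f : E → ℝ≥0∞) :
    ∫⁻ x, f x ∂(midpoint u v : Measure E) =
      2⁻¹ * ∫⁻ x, f x ∂(u : Measure E) + 2⁻¹ * ∫⁻ x, f x ∂(v : Measure E) := by
  simp [toMeasure_midpoint]

theorem midpoint_mem_P2 {u v : ProbabilityMeasure (Rd d)} (hu : u ∈ P2 d) (hv : v ∈ P2 d) :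
    midpoint u v ∈ P2 d := by
  change ∫⁻ x, ‖x‖ₑ ^ 2 ∂(midpoint u v : Measure (Rd d)) < ∞
  rw [lintegral_midpoint]
  exact ENNReal.add_lt_top.2 ⟨ENNReal.mul_lt_top (by simp) hu, ENNReal.mul_lt_top (by simp) hv⟩

theorem midpoint_mem_plans {u v w : ProbabilityMeasure (Rd d)}
    {γ η : ProbabilityMeasure (Rd d × Rd d)} (hγ : γ ∈ plans u w) (hη : η ∈ plans v w) :
    midpoint γ η ∈ plans (midpoint u v) w := by
  constructor
  · rw [toMeasure_midpoint, Measure.map_add _ _ measurable_fst, Measure.map_smul, Measure.map_smul,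
      hγ.1, hη.1, toMeasure_midpoint]
  · rw [toMeasure_midpoint, Measure.map_add _ _ measurable_snd, Measure.map_smul, Measure.map_smul,
      hγ.2, hη.2, ← add_smul, ENNReal.inv_two_add_inv_two, one_smul]

theorem W_sq_midpoint_le (u v w : ProbabilityMeasure (Rd d)) :
    W (midpoint u v) w ^ 2 ≤ 2⁻¹ * W u w ^ 2 + 2⁻¹ * W v w ^ 2 := by
  rw [W_sq u, W_sq v, iInf_subtype', iInf_subtype', ENNReal.mul_iInf_of_ne (by simp) (by simp),
    ENNReal.mul_iInf_of_ne (by simp) (by simp), ENNReal.iInf_add]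
  refine le_iInf fun γ => ?_
  rw [ENNReal.add_iInf]
  refine le_iInf fun η => ?_
  rw [W_sq, ← lintegral_midpoint]
  exact iInf₂_le _ (midpoint_mem_plans γ.2 η.2)

theorem fourier_midpoint (u v : ProbabilityMeasure (Rd d)) (ξ : Rd d) :
    fourier (midpoint u v) ξ = 2⁻¹ * (fourier u ξ + fourier v ξ) := by
  have hint (w : ProbabilityMeasure (Rd d)) : Integrable
      (fun x : Rd d => Complex.exp (-(Complex.I * ((⟪ξ, x⟫ : ℝ) : ℂ)))) (w : Measure (Rd d)) := by
    refine Integrable.of_bound (C := 1) (Continuous.aestronglyMeasurable (by fun_prop)) ?_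
    refine Eventually.of_forall fun x => ?_
    rw [Complex.norm_exp]
    simp
  rw [fourier, toMeasure_midpoint, integral_add_measure ((hint u).smul_measure (by simp))
    ((hint v).smul_measure (by simp)), integral_smul_measure, integral_smul_measure, fourier,
    fourier]
  simp
  ring

theorem enorm_sq_parallelogram (a b : ℂ) :
    ‖2⁻¹ * (a + b)‖ₑ ^ 2 + 4⁻¹ * ‖a - b‖ₑ ^ 2 = 2⁻¹ * ‖a‖ₑ ^ 2 + 2⁻¹ * ‖b‖ₑ ^ 2 := by
  have h := parallelogram_law_with_norm ℝ a b
  have h2 : ‖2⁻¹ * (a + b)‖ = 2⁻¹ * ‖a + b‖ := by simp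
  have e2 : (2⁻¹ : ℝ≥0∞) = ((2⁻¹ : ℝ≥0) : ℝ≥0∞) := by simp
  have e4 : (4⁻¹ : ℝ≥0∞) = ((4⁻¹ : ℝ≥0) : ℝ≥0∞) := by
    rw [ENNReal.coe_inv (by norm_num)]; simp
  rw [e2, e4]
  simp only [enorm_eq_nnnorm]
  norm_cast
  rw [← NNReal.coe_inj]
  push_cast
  rw [h2]
  linarith

/-- The parallelogram law integrated against `ψ⁻¹`. Keeping the convexity defect as a summand avoids
subtraction in `ℝ≥0∞`, so infinite energies are allowed. -/
theorem energy_midpoint_add {ν : Rd d → ℝ} (hν : IsLevyKernel ν)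
    (u v : ProbabilityMeasure (Rd d)) :
    energy ν (midpoint u v) + 2⁻¹ * (4⁻¹ * ∫⁻ ξ : Rd d, ‖fourier u ξ - fourier v ξ‖ₑ ^ 2 *
      (ENNReal.ofReal (symbol ν ξ))⁻¹) = 2⁻¹ * energy ν u + 2⁻¹ * energy ν v := by
  have hu := measurable_energy_density hν (continuous_fourier u)
  have hv := measurable_energy_density hν (continuous_fourier v)
  have hm := measurable_energy_density hν (continuous_fourier (midpoint u v))
  have hd := measurable_energy_density hν ((continuous_fourier u).sub (continuous_fourier v))
  simp only [energy]
  rw [mul_left_comm 2⁻¹ 2⁻¹, mul_left_comm 2⁻¹ 2⁻¹, ← mul_add, ← mul_add]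
  simp only [Pi.sub_apply] at hd
  rw [← lintegral_const_mul _ hu, ← lintegral_const_mul _ hv, ← lintegral_const_mul _ hd,
    ← lintegral_add_left hm, ← lintegral_add_left (hu.const_mul _)]
  congr 2 with ξ
  rw [← mul_assoc, ← mul_assoc, ← mul_assoc, ← add_mul, ← add_mul, fourier_midpoint,
    enorm_sq_parallelogram]

/-- The weight `ψ⁻¹` never vanishes because `ψ` is finite, so a zero integral forces `û = v̂` a.e.,
then everywhere by continuity. -/
theorem lintegral_fourier_sub_ne_zero {ν : Rd d → ℝ} (hν : IsLevyKernel ν)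
    {u v : ProbabilityMeasure (Rd d)} (huv : u ≠ v) :
    ∫⁻ ξ : Rd d, ‖fourier u ξ - fourier v ξ‖ₑ ^ 2 * (ENNReal.ofReal (symbol ν ξ))⁻¹ ≠ 0 := by
  intro h
  apply huv
  replace h := (lintegral_eq_zero_iff
    (measurable_energy_density hν ((continuous_fourier u).sub (continuous_fourier v)))).1 h
  apply fourier_injective
  refine (Continuous.ae_eq_iff_eq volume (continuous_fourier u) (continuous_fourier v)).1 ?_
  filter_upwards [h] with ξ hξ
  simpa [sub_eq_zero] using hξ

theorem energy_midpoint_lt {ν : Rd d → ℝ} (hν : IsLevyKernel ν)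
    {u v : ProbabilityMeasure (Rd d)} (huv : u ≠ v) (hu : energy ν u ≠ ∞) (hv : energy ν v ≠ ∞) :
    energy ν (midpoint u v) < 2⁻¹ * energy ν u + 2⁻¹ * energy ν v := by
  have h := energy_midpoint_add hν u v
  have hfin : 2⁻¹ * energy ν u + 2⁻¹ * energy ν v ≠ ∞ := by finiteness
  rw [← h] at hfin ⊢
  refine ENNReal.lt_add_right (ne_top_of_le_ne_top hfin le_self_add) ?_
  simpa using lintegral_fourier_sub_ne_zero hν huv

end Energy

/-! ### Existence and uniqueness of the minimizer. -/

section MoreauYosida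

variable {d : ℕ} {ν : Rd d → ℝ} {τ : ℝ} {uStar : ProbabilityMeasure (Rd d)}

theorem lowerSemicontinuous_moreauYosida (hν : IsLevyKernel ν) (hτ : 0 < τ)
    (huStar : uStar ∈ P2 d) : LowerSemicontinuous (moreauYosida ν τ uStar) := by
  have hτ' : ENNReal.ofReal (2 * τ) ≠ 0 := by simpa using hτ
  have h : LowerSemicontinuous fun u => W u uStar ^ 2 / ENNReal.ofReal (2 * τ) :=
    Continuous.comp_lowerSemicontinuous (g := fun x : ℝ≥0∞ => x / ENNReal.ofReal (2 * τ))
      (ENNReal.continuous_div_const _ hτ') (lowerSemicontinuous_W_sq huStar)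
      fun a b hab => ENNReal.div_le_div_right hab _
  exact h.add (lowerSemicontinuous_energy hν)

theorem moreauYosida_lt_top (hτ : 0 < τ) (huStar : uStar ∈ P2 d) {u : ProbabilityMeasure (Rd d)}
    (hu : u ∈ energyDomain ν) : moreauYosida ν τ uStar u < ∞ := by
  have hτ' : ENNReal.ofReal (2 * τ) ≠ 0 := by simpa using hτ
  exact ENNReal.add_lt_top.2 ⟨ENNReal.div_lt_top (W_sq_lt_top hu.1 huStar).ne hτ', hu.2⟩

theorem secondMoment_le_moreauYosida (hτ : 0 < τ) (u : ProbabilityMeasure (Rd d)) :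
    ∫⁻ x, ‖x‖ₑ ^ 2 ∂(u : Measure (Rd d)) ≤
      2 * (moreauYosida ν τ uStar u * ENNReal.ofReal (2 * τ)) +
        2 * ∫⁻ x, ‖x‖ₑ ^ 2 ∂(uStar : Measure (Rd d)) := by
  have hτ' : ENNReal.ofReal (2 * τ) ≠ 0 := by simpa using hτ
  refine (secondMoment_le_W u uStar).trans ?_
  gcongr
  exact (ENNReal.div_le_iff hτ' ENNReal.ofReal_ne_top).1 le_self_add

theorem exists_isMinOn_moreauYosida (hν : IsLevyKernel ν) (hτ : 0 < τ) (huStar : uStar ∈ P2 d)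
    (hne : (energyDomain ν).Nonempty) :
    ∃ u ∈ P2 d, IsMinOn (moreauYosida ν τ uStar) (P2 d) u := by
  obtain ⟨v, hv⟩ := hne
  have hvfin := (moreauYosida_lt_top hτ huStar hv).ne
  have hM : ∫⁻ x, ‖x‖ₑ ^ 2 ∂(uStar : Measure (Rd d)) ≠ ∞ := ne_of_lt huStar
  set C : ℝ≥0∞ := 2 * (moreauYosida ν τ uStar v * ENNReal.ofReal (2 * τ)) +
        2 * ∫⁻ x, ‖x‖ₑ ^ 2 ∂(uStar : Measure (Rd d)) with hCdef
  have hC : C ≠ ∞ := by finiteness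
  have hvC : v ∈ {μ : ProbabilityMeasure (Rd d) | ∫⁻ x, ‖x‖ₑ ^ 2 ∂(μ : Measure (Rd d)) ≤ C} :=
    secondMoment_le_moreauYosida hτ v
  obtain ⟨u, huC, hu⟩ := ((lowerSemicontinuous_moreauYosida hν hτ huStar).lowerSemicontinuousOn
    _).exists_isMinOn ⟨v, hvC⟩ (isCompact_secondMoment_le hC)
  refine ⟨u, lt_of_le_of_lt huC hC.lt_top, fun w _ => ?_⟩
  -- A competitor no worse than `v` lies in the compact set; any other is beaten by `v`, which lies
  -- there too.
  rcases le_total (moreauYosida ν τ uStar w) (moreauYosida ν τ uStar v) with h | h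
  · refine hu ((secondMoment_le_moreauYosida (ν := ν) (uStar := uStar) hτ w).trans ?_)
    rw [hCdef]
    gcongr
  · exact (hu hvC).trans h

theorem moreauYosida_midpoint_lt (hν : IsLevyKernel ν) {u v : ProbabilityMeasure (Rd d)}
    (huv : u ≠ v) (hu : moreauYosida ν τ uStar u ≠ ∞) (hv : moreauYosida ν τ uStar v ≠ ∞) :
    moreauYosida ν τ uStar (midpoint u v) <
      2⁻¹ * moreauYosida ν τ uStar u + 2⁻¹ * moreauYosida ν τ uStar v := by
  rw [moreauYosida, ENNReal.add_ne_top] at hu hv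
  have hW : W (midpoint u v) uStar ^ 2 / ENNReal.ofReal (2 * τ) ≤
      2⁻¹ * (W u uStar ^ 2 / ENNReal.ofReal (2 * τ)) +
        2⁻¹ * (W v uStar ^ 2 / ENNReal.ofReal (2 * τ)) := by
    rw [← mul_div_assoc, ← mul_div_assoc, ← ENNReal.add_div]
    exact ENNReal.div_le_div_right (W_sq_midpoint_le u v uStar) _
  have hWfin := ne_top_of_le_ne_top (ENNReal.add_ne_top.2
    ⟨ENNReal.mul_ne_top (by simp) hu.1, ENNReal.mul_ne_top (by simp) hv.1⟩) hW
  calc moreauYosida ν τ uStar (midpoint u v)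
      < _ + _ := ENNReal.add_lt_add_of_le_of_lt hWfin hW (energy_midpoint_lt hν huv hu.2 hv.2)
    _ = _ := by simp only [moreauYosida]; ring

theorem eq_of_isMinOn_moreauYosida (hν : IsLevyKernel ν) (hτ : 0 < τ) (huStar : uStar ∈ P2 d)
    (hne : (energyDomain ν).Nonempty) {u v : ProbabilityMeasure (Rd d)} (hu : u ∈ P2 d)
    (hv : v ∈ P2 d) (humin : IsMinOn (moreauYosida ν τ uStar) (P2 d) u)
    (hvmin : IsMinOn (moreauYosida ν τ uStar) (P2 d) v) : u = v := by
  by_contra huv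
  obtain ⟨w, hw⟩ := hne
  -- Strict convexity needs a finite minimal value, which `w` guarantees.
  have hufin := ((humin hw.1).trans_lt (moreauYosida_lt_top hτ huStar hw)).ne
  have heq : moreauYosida ν τ uStar v = moreauYosida ν τ uStar u :=
    le_antisymm (hvmin hu) (humin hv)
  have h := moreauYosida_midpoint_lt hν huv hufin (heq ▸ hufin)
  rw [heq, ← add_mul, ENNReal.inv_two_add_inv_two, one_mul] at h
  exact (humin (midpoint_mem_P2 hu hv)).not_gt h

end MoreauYosida

end LevyEnergy

end

theorem theorem3p1 {d : ℕ} (ν : LevyEnergy.Rd d → ℝ) (hν : LevyEnergy.IsLevyKernel ν)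
    (uStar : MeasureTheory.ProbabilityMeasure (LevyEnergy.Rd d))
    (huStar : uStar ∈ LevyEnergy.P2 d) (τ : ℝ) (hτ : 0 < τ) :
    LowerSemicontinuousOn (LevyEnergy.moreauYosida ν τ uStar) (LevyEnergy.P2 d) ∧
    ((LevyEnergy.energyDomain ν).Nonempty →
      ∃! u : MeasureTheory.ProbabilityMeasure (LevyEnergy.Rd d),
        u ∈ LevyEnergy.P2 d ∧
          IsMinOn (LevyEnergy.moreauYosida ν τ uStar) (LevyEnergy.P2 d) u) := by
  refine ⟨(LevyEnergy.lowerSemicontinuous_moreauYosida hν hτ huStar).lowerSemicontinuousOn _,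
    fun hne => ?_⟩
  obtain ⟨u, hu, hmin⟩ := LevyEnergy.exists_isMinOn_moreauYosida hν hτ huStar hne
  exact ⟨u, ⟨hu, hmin⟩, fun v hv =>
    LevyEnergy.eq_of_isMinOn_moreauYosida hν hτ huStar hne hv.1 hu hv.2 hmin⟩
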